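/- Let $n\ge 1$, let $E_{n+1}=(0,\dots,0,1)\in\mathbf R^{n+1}$, $\overline{\mathbf R^{n+1}_+}=\{z: z\cdot E_{n+1}\ge 0\}$ and $\partial\mathbf R^{n+1}_+=\{z: z\cdot E_{n+1}=0\}$, and let $\mathcal H^k$ be the $k$-dimensional Hausdorff measure. A Borel set $S$ is *locally $\mathcal H^k$-rectifiable* if it is covered, up to an $\mathcal H^k$-null set, by countably many Lipschitz images of $\mathbf R^k$ and $\mathcal H^k\llcorner S$ is locally finite; it is *normalized* if $S=\operatorname{spt}(\mathcal H^k\llcorner S)$. Write $T_xS$ for its approximate tangent plane (defined $\mathcal H^k$-a.e. on $S$) and $\operatorname{div}_S X$ for the divergence of $X$ along $T_xS$. Let $\mathfrak X$ be the set of compactly supported $C^1$ vector fields $X$ on $\mathbf R^{n+1}$ with $X\cdot E_{n+1}\ge 0$ on $\partial\mathbf R^{n+1}_+$, and $\mathfrak X_t$ the set of those with $X\cdot E_{n+1}=0$ on $\partial\mathbf R^{n+1}_+$. Let $\theta\in(0,\pi)$. Let $M\subset\overline{\mathbf R^{n+1}_+}$ and $T\subset\partial\mathbf R^{n+1}_+$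 be normalized locally $\mathcal H^n$-rectifiable sets, let $\Gamma\subset\partial\mathbf R^{n+1}_+$ be a normalized locally $\mathcal H^{n-1}$-rectifiable set, and let $\psi_1$ be a positive locally $\mathcal H^n$-integrable function on $M$. The triple $(\mathrm{var}(M,\psi_1),\mathrm{var}(T),\mathrm{var}(\Gamma))$ is *$\theta$-stationary* if there is an $\mathcal H^n\llcorner M$-integrable vector field $\mathbf H$ with $\mathbf H=0$ $\mathcal H^n$-a.e. on $M$ such that $$\int_M\psi_1\operatorname{div}_MX\,d\mathcal H^n+\cos(\pi-\theta)\int_T\operatorname{div}_{\partial\mathbf R^{n+1}_+}X\,d\mathcal H^n=-\int_M\psi_1X\cdot\mathbf H\,d\mathcal H^n-\sin\theta\int_\Gamma X\cdot E_{n+1}\,d\mathcal H^{n-1}\quad\forall X\in\mathfrak X,$$ and there is a locally $\mathcal H^{n-1}\llcorner\Gamma$-integrable vector field $\bar\nu$ with $|\bar\nu|=1$ $\mathcal H^{n-1}$-a.e. on $\Gamma$ and $$\int_T\operatorname{div}_{\partial\mathbf R^{n+1}_+}X\,d\mathcal H^n=\int_\Gamma X\cdot\bar\nu\,d\mathcal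 H^{n-1}\quad\forall X\in\mathfrak X_t.$$ **Statement.** Let $\theta\in(0,\pi)$, let $\nu\in\mathbf R^{n+1}$ be a unit vector, $H^-=\{z:z\cdot\nu\le0\}$, $H^+=\{z:z\cdot\nu\ge0\}$, $T=H^+\cap\partial\mathbf R^{n+1}_+$ and $\Gamma=\partial H^+\cap\partial\mathbf R^{n+1}_+$. Suppose that $\mathrm{var}(M,\psi_1)$ is a cone, i.e. $M=tM$ and $\psi_1(tx)=\psi_1(x)$ for all $x\in M$ and $t>0$, that $(\mathrm{var}(M,\psi_1),\mathrm{var}(T),\mathrm{var}(\Gamma))$ is $\theta$-stationary, and that $M\subset H^-$. Then $$\alpha:=\arccos\bigl(\nu\cdot(-E_{n+1})\bigr)\le\theta,$$ and if $\alpha=\theta$, then $M=\partial H^-\cap\overline{\mathbf R^{n+1}_+}$. -/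

import Mathlib

open MeasureTheory Filter Topology
open scoped Pointwise RealInnerProductSpace

noncomputable section

namespace Capillary

/-- Euclidean space `ℝ^{n+1}`. -/
abbrev Space (n : ℕ) : Type := EuclideanSpace ℝ (Fin (n + 1))

/-- The last coordinate unit vector `E_{n+1}`. -/
def lastVec (n : ℕ) : Space n := EuclideanSpace.single (Fin.last n) 1

/-- The closed upper half-space `{z : z_{n+1} ≥ 0}`. -/
def upperHalf (n : ℕ) : Set (Space n) := {z | 0 ≤ z (Fin.last n)}

/-- The boundary hyperplane `{z : z_{n+1} = 0}` of the upper half-space. -/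
def wall (n : ℕ) : Set (Space n) := {z | z (Fin.last n) = 0}

/-- The closed half-space `H⁻ = {z : z · ν ≤ 0}`. -/
def halfMinus {n : ℕ} (ν : Space n) : Set (Space n) := {z | ⟪z, ν⟫ ≤ 0}

/-- The opposite closed half-space `H⁺ = {z : z · ν ≥ 0}`. -/
def halfPlus {n : ℕ} (ν : Space n) : Set (Space n) := {z | 0 ≤ ⟪z, ν⟫}

/-! Throughout, `μHE[k]` is the `k`-dimensional Hausdorff measure with the Euclidean normalization
(it is Lebesgue measure on `ℝ^k`). -/

/-- Locally `ℋ^k`-rectifiable sets: Borel, covered up to an `ℋ^k`-null set by countably many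
Lipschitz images of `ℝ^k`, and with `ℋ^k ⌞ M` locally finite. -/
structure IsLocRectifiable {n : ℕ} (k : ℕ) (M : Set (Space n)) : Prop where
  measurableSet : MeasurableSet M
  cover : ∃ f : ℕ → EuclideanSpace ℝ (Fin k) → Space n,
    (∀ i, ∃ K, LipschitzWith K (f i)) ∧ μHE[k] (M \ ⋃ i, Set.range (f i)) = 0
  locallyFinite : IsLocallyFiniteMeasure (μHE[k].restrict M)

/-- `M` is normalized: it is the support of `ℋ^k ⌞ M`. -/
def IsNormalized {n : ℕ} (k : ℕ) (M : Set (Space n)) : Prop :=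
  ∀ x, x ∈ M ↔ ∀ ρ : ℝ, 0 < ρ → 0 < μHE[k] (M ∩ Metric.ball x ρ)

/-- The `k`-dimensional subspace `P` is the approximate tangent plane of `M` at `x`: the rescaled
measures `r^{-k} ℋ^k ⌞ ((M - x) / r)` converge weakly-* to `ℋ^k ⌞ P` as `r → 0⁺`. -/
def IsApproxTangentPlane {n : ℕ} (k : ℕ) (M : Set (Space n)) (x : Space n)
    (P : Submodule ℝ (Space n)) : Prop :=
  Module.finrank ℝ P = k ∧
    ∀ φ : Space n → ℝ, Continuous φ → HasCompactSupport φ →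
      Tendsto (fun r : ℝ => (r ^ k)⁻¹ * ∫ y in M, φ (r⁻¹ • (y - x)) ∂μHE[k]) (𝓝[>] 0)
        (𝓝 (∫ y in (P : Set (Space n)), φ y ∂μHE[k]))

open Classical in
/-- The approximate tangent plane `T_x M`. For a locally `ℋ^k`-rectifiable set it exists, and is
unique, at `ℋ^k`-a.e. point of `M`; at the remaining points the value is by convention the whole
space. -/
def tangentPlane {n : ℕ} (k : ℕ) (M : Set (Space n)) (x : Space n) : Submodule ℝ (Space n) :=
  if h : ∃ P, IsApproxTangentPlane k M x P then h.choose else ⊤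

/-- The divergence of `X` at `x` along the subspace `P`: the trace of `π_P ∘ DX(x)`, that is
`∑ᵢ ⟨DX(x) τᵢ, τᵢ⟩` over an orthonormal basis `τᵢ` of `P`. -/
def divAlong {n : ℕ} (P : Submodule ℝ (Space n)) (X : Space n → Space n) (x : Space n) : ℝ :=
  LinearMap.trace ℝ (Space n) (P.starProjection ∘L fderiv ℝ X x).toLinearMap

/-- The tangential divergence `div_M X` of a `k`-rectifiable set `M`. -/
def divOn {n : ℕ} (k : ℕ) (M : Set (Space n)) (X : Space n → Space n) (x : Space n) : ℝ :=
  divAlong (tangentPlane k M x) X x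

/-- The divergence along the boundary hyperplane of the half-space. -/
def divWall {n : ℕ} (X : Space n → Space n) (x : Space n) : ℝ :=
  divAlong (ℝ ∙ lastVec n)ᗮ X x

/-- Compactly supported `C¹` vector fields on `ℝ^{n+1}` that take values in the tangent space of
the closed upper half-space at each of its points: this is no condition at interior points, and at
a boundary point the tangent space is the half-space `{v : v · E_{n+1} ≥ 0}`. -/
structure IsAdmissible {n : ℕ} (X : Space n → Space n) : Prop where
  contDiff : ContDiff ℝ 1 X
  compactSupport : HasCompactSupport X
  inward : ∀ p ∈ wall n, 0 ≤ ⟪X p, lastVec n⟫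

/-- Compactly supported `C¹` vector fields on `ℝ^{n+1}` that are tangential to the boundary
hyperplane along it. -/
structure IsTangential {n : ℕ} (X : Space n → Space n) : Prop where
  contDiff : ContDiff ℝ 1 X
  compactSupport : HasCompactSupport X
  tangent : ∀ p ∈ wall n, ⟪X p, lastVec n⟫ = 0

/-- The triple `(var(M, ψ), var(T), var(Γ))` satisfies the contact angle condition `θ` with
generalized mean curvature vector `H`. -/
structure HasContactAngle {n : ℕ} (θ : ℝ) (M : Set (Space n)) (ψ : Space n → ℝ)
    (T Γ : Set (Space n)) (H : Space n → Space n) : Prop where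
  M_subset : M ⊆ upperHalf n
  T_subset : T ⊆ wall n
  Γ_subset : Γ ⊆ wall n
  M_rectifiable : IsLocRectifiable n M
  M_normalized : IsNormalized n M
  T_rectifiable : IsLocRectifiable n T
  T_normalized : IsNormalized n T
  Γ_rectifiable : IsLocRectifiable (n - 1) Γ
  Γ_normalized : IsNormalized (n - 1) Γ
  ψ_pos : ∀ x ∈ M, 0 < ψ x
  ψ_locallyIntegrable : LocallyIntegrable ψ (μHE[n].restrict M)
  H_integrable : Integrable H (μHE[n].restrict M)
  firstVariation : ∀ X : Space n → Space n, IsAdmissible X →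
    (∫ x in M, ψ x * divOn n M X x ∂μHE[n])
        + Real.cos (Real.pi - θ) * ∫ x in T, divWall X x ∂μHE[n]
      = -(∫ x in M, ψ x * ⟪X x, H x⟫ ∂μHE[n])
        - Real.sin θ * ∫ x in Γ, ⟪X x, lastVec n⟫ ∂μHE[n - 1]
  conormal : ∃ νbar : Space n → Space n,
    LocallyIntegrable νbar (μHE[n - 1].restrict Γ) ∧
    (∀ᵐ x ∂(μHE[n - 1].restrict Γ), ‖νbar x‖ = 1) ∧
    ∀ X : Space n → Space n, IsTangential X →
      ∫ x in T, divWall X x ∂μHE[n] = ∫ x in Γ, ⟪X x, νbar x⟫ ∂μHE[n - 1]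

/-- `(var(M, ψ), var(T), var(Γ))` is a `θ`-stationary triple: it satisfies the contact angle
condition `θ` with a generalized mean curvature vector that vanishes a.e. on `M`. -/
def IsStationaryTriple {n : ℕ} (θ : ℝ) (M : Set (Space n)) (ψ : Space n → ℝ)
    (T Γ : Set (Space n)) : Prop :=
  ∃ H : Space n → Space n, HasContactAngle θ M ψ T Γ H ∧ H =ᵐ[μHE[n].restrict M] 0

/-- `var(M, ψ)` is a cone: `M = tM` for every `t > 0`, and `ψ` is homogeneous of degree zero on
`M`. -/
def IsVarifoldCone {n : ℕ} (M : Set (Space n)) (ψ : Space n → ℝ) : Prop :=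
  ∀ t : ℝ, 0 < t → t • M = M ∧ ∀ x ∈ M, ψ (t • x) = ψ x

end Capillary

end

/-!
The proof tests stationarity only with fields `X = φ w` of constant direction `w`, for which
`div_P X = dφ(π_P w)` for every subspace `P`. Write `E` for the last coordinate vector. Since `Γ` is
locally of finite `ℋ^{n-1}` measure, `ν` is not a multiple of `E`
(`not_isLocRectifiable_wall`), so `ν = sin α e - cos α E` with `e` a unit vector of the boundary
hyperplane; `T` is a half-hyperplane with inner normal `e` and edge `Γ = {e, E}^⊥`. The divergence
theorem on `T` (`setIntegral_halfSpace_fderiv`) turns the first variation into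
`∫_M ψ dφ(π (a e + b E)) = -(a cos θ + b sin θ) ∫_Γ φ`, where `π` is the projection to the tangent
plane (`IsStationaryTriple.firstVariation_smul`).

For the inequality, take `φ = ((1 - |x|²)₊)²`. The tangent plane of a cone contains the position
vector (`IsApproxTangentPlane.mem_of_cone`), hence `dφ(π w) = dφ(w)`, and with `w = ν` this gives
`4 ∫_M ψ (1 - |x|²)₊ (x · ν) = sin (α - θ) ∫_Γ φ`. The left side is nonpositive as `M ⊆ H⁻`, so
`α ≤ θ`.

If `α = θ`, the left side vanishes, and then `M ⊆ ν^⊥` because `M` is a normalized cone. Every tangent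
plane of `M` that exists is now `ν^⊥` (`IsApproxTangentPlane.eq_of_subset`), so with
`v = cos θ e + sin θ E`, which lies in `ν^⊥`, stationarity reads `∫_M ψ ∂_v φ = -∫_Γ φ`. Were a point
`q + t v`, `q ∈ Γ`, `t ≥ 0`, missing from the closed set `M`, a cut-off `φ ≥ 0` with `φ(q) > 0` and
`∂_v φ = 0` on `{x · v ≥ 0} ⊇ M` away from a neighbourhood of that point (`exists_segment_cutoff`)
would contradict this.

Approximate tangent planes need not be shown to exist: where there is none, `tangentPlane` is the
whole space, which contains `x` and `v` as well.
-/

namespace Capillary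

/-! ### Integration over subspaces and half-spaces -/

section HausdorffOnSubspaces

variable {V : Type*} [NormedAddCommGroup V] [InnerProductSpace ℝ V] [FiniteDimensional ℝ V]
  [MeasurableSpace V] [BorelSpace V]

theorem restrict_submodule_eq_map (P : Submodule ℝ V) {k : ℕ} (hk : Module.finrank ℝ P = k) :
    (μHE[k] : Measure V).restrict P = (volume : Measure P).map Subtype.val := by
  subst hk
  rw [← InnerProductSpace.euclideanHausdorffMeasure_eq_volume,
    isometry_subtype_coe.map_euclideanHausdorffMeasure, Subtype.range_coe]

theorem setIntegral_submodule (P : Submodule ℝ V) {k : ℕ} (hk : Module.finrank ℝ P = k)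
    (φ : V → ℝ) : ∫ y in (P : Set V), φ y ∂μHE[k] = ∫ y : P, φ y := by
  rw [restrict_submodule_eq_map P hk]
  exact (MeasurableEmbedding.subtype_coe
    P.closed_of_finiteDimensional.measurableSet).integral_map φ

theorem setIntegral_submodule_pos (P : Submodule ℝ V) {k : ℕ} (hk : Module.finrank ℝ P = k)
    {φ : V → ℝ} (hφ : Continuous φ) (hc : HasCompactSupport φ) (h0 : ∀ y, 0 ≤ φ y) {z : V}
    (hz : z ∈ P) (hφz : φ z ≠ 0) : 0 < ∫ y in (P : Set V), φ y ∂μHE[k] := by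
  rw [setIntegral_submodule P hk]
  refine Continuous.integral_pos_of_hasCompactSupport_nonneg_nonzero (x := ⟨z, hz⟩)
    (f := fun y : P => φ y) (by fun_prop) ?_ (fun y => h0 y) hφz
  exact hc.comp_isClosedEmbedding P.closed_of_finiteDimensional.isClosedEmbedding_subtypeVal

theorem measure_submodule_inter_ball_pos (P : Submodule ℝ V) {k : ℕ}
    (hk : Module.finrank ℝ P = k) : 0 < μHE[k] ((P : Set V) ∩ Metric.ball 0 1) := by
  rw [Set.inter_comm, ← Measure.restrict_apply Metric.isOpen_ball.measurableSet,
    restrict_submodule_eq_map P hk,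
    Measure.map_apply measurable_subtype_coe Metric.isOpen_ball.measurableSet]
  refine (Metric.isOpen_ball.preimage continuous_subtype_val).measure_pos _ ⟨0, ?_⟩
  simp

/-- The divergence theorem on the half-space `{y + s e : y ∈ G, s ≥ 0}` bounded by the subspace
`G`, for vector fields parallel to the inner unit normal `e`. -/
theorem setIntegral_halfSpace_fderiv (G : Submodule ℝ V) {m : ℕ} (hm : Module.finrank ℝ G = m)
    {e : V} (he : ‖e‖ = 1) (heG : ∀ y ∈ G, ⟪y, e⟫ = 0) {φ : V → ℝ} (hφ : ContDiff ℝ 1 φ)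
    (hc : HasCompactSupport φ) :
    ∫ x in {x | 0 ≤ ⟪x, e⟫ ∧ x - ⟪x, e⟫ • e ∈ G}, fderiv ℝ φ x e ∂μHE[m + 1]
      = -∫ x in (G : Set V), φ x ∂μHE[m] := by
  have hee : ⟪e, e⟫ = 1 := by simp [he]
  -- `J (s, y) = y + s e` is an isometry of the `ℓ²`-product `ℝ × G` into `V`.
  let J : WithLp 2 (ℝ × G) →ₗ[ℝ] V :=
    { toFun := fun p => p.fst • e + (p.snd : V)
      map_add' := fun p q => by simp [add_smul]; abel
      map_smul' := fun r p => by simp [mul_smul] }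
  have hJ : ∀ p, J p = p.fst • e + (p.snd : V) := fun p => rfl
  have hJnorm : ∀ p, ‖J p‖ = ‖p‖ := by
    intro p
    have h1 : ‖J p‖ ^ 2 = ‖p‖ ^ 2 := by
      rw [hJ, norm_add_sq_real, WithLp.prod_norm_sq_eq_of_L2, real_inner_smul_left,
        real_inner_comm, heG _ p.snd.2, norm_smul, he]
      simp
    exact (sq_eq_sq₀ (norm_nonneg _) (norm_nonneg _)).1 h1
  have hJiso : Isometry J := AddMonoidHomClass.isometry_of_norm J hJnorm
  have hrange : Set.range J = {x | x - ⟪x, e⟫ • e ∈ G} := by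
    ext x
    constructor
    · rintro ⟨p, rfl⟩
      have : ⟪J p, e⟫ = p.fst := by
        rw [hJ, inner_add_left, real_inner_smul_left, hee, heG _ p.snd.2]; simp
      simp only [Set.mem_ofPred_eq, this]
      simp [hJ]
    · intro hx
      exact ⟨WithLp.toLp 2 (⟪x, e⟫, ⟨_, hx⟩), by simp [hJ]⟩
  have hdim : Module.finrank ℝ (WithLp 2 (ℝ × G)) = m + 1 := by
    rw [(WithLp.linearEquiv 2 ℝ (ℝ × G)).finrank_eq, Module.finrank_prod, hm]
    simp [add_comm]
  have hmap : (μHE[m + 1] : Measure V).restrict (Set.range J)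
      = (volume : Measure (ℝ × G)).map (fun p => p.1 • e + (p.2 : V)) := by
    rw [← hJiso.map_euclideanHausdorffMeasure, ← hdim,
      InnerProductSpace.euclideanHausdorffMeasure_eq_volume,
      ← (WithLp.volume_preserving_toLp ℝ G).map_eq,
      Measure.map_map hJiso.continuous.measurable (WithLp.volume_preserving_toLp ℝ G).measurable]
    rfl
  have hjc : Continuous (fun p : ℝ × G => p.1 • e + (p.2 : V)) := by fun_prop
  have hjemb : IsClosedEmbedding (fun p : ℝ × G => p.1 • e + (p.2 : V)) := by
    have h2 : (fun p : ℝ × G => p.1 • e + (p.2 : V)) = J ∘ (WithLp.homeomorphProd 2 ℝ G).symm :=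
      rfl
    rw [h2]
    exact hJiso.isClosedEmbedding.comp (Homeomorph.isClosedEmbedding _)
  have hdc : Continuous fun x => fderiv ℝ φ x e :=
    (hφ.continuous_fderiv one_ne_zero).clm_apply continuous_const
  have hdsupp : HasCompactSupport fun x => fderiv ℝ φ x e :=
    hc.fderiv_apply ℝ e
  have hsplit : {x | 0 ≤ ⟪x, e⟫ ∧ x - ⟪x, e⟫ • e ∈ G} = {x | 0 ≤ ⟪x, e⟫} ∩ Set.range J := by
    rw [hrange]; rfl
  have hmeas : MeasurableSet {x : V | 0 ≤ ⟪x, e⟫} :=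
    (isClosed_le continuous_const (by fun_prop)).measurableSet
  have hpre : (fun p : ℝ × G => p.1 • e + (p.2 : V)) ⁻¹' {x : V | 0 ≤ ⟪x, e⟫}
      = Set.Ici 0 ×ˢ Set.univ := by
    ext p
    have : ⟪p.1 • e + (p.2 : V), e⟫ = p.1 := by
      rw [inner_add_left, real_inner_smul_left, hee, heG _ p.2.2]; simp
    simp [this]
  rw [hsplit, ← Measure.restrict_restrict hmeas, hmap, hjemb.measurableEmbedding.restrict_map,
    hjemb.measurableEmbedding.integral_map, hpre, setIntegral_submodule G hm,
    Measure.volume_eq_prod, ← Measure.prod_restrict, Measure.restrict_univ,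
    integral_prod_symm, ← integral_neg]
  · congr 1
    ext y
    rw [integral_Ici_eq_integral_Ioi]
    have hd : ∀ s : ℝ, HasDerivAt (fun s : ℝ => φ (s • e + (y : V)))
        (fderiv ℝ φ (s • e + (y : V)) e) s := by
      intro s
      have h1 : HasDerivAt (fun s : ℝ => s • e + (y : V)) e s := by
        simpa using ((hasDerivAt_id s).smul_const e).add_const (y : V)
      exact ((hφ.differentiable one_ne_zero _).hasFDerivAt).comp_hasDerivAt s h1
    have hline : IsClosedEmbedding (fun s : ℝ => s • e + (y : V)) := by
      refine Isometry.isClosedEmbedding (Isometry.of_dist_eq fun a b => ?_)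
      rw [dist_add_right, dist_eq_norm, ← sub_smul, norm_smul, he, mul_one, Real.dist_eq,
        Real.norm_eq_abs]
    have hlc : HasCompactSupport (fun s : ℝ => φ (s • e + (y : V))) :=
      hc.comp_isClosedEmbedding hline
    have hldc : HasCompactSupport (fun s : ℝ => fderiv ℝ φ (s • e + (y : V)) e) :=
      hdsupp.comp_isClosedEmbedding hline
    have h3 := integral_Ioi_of_hasDerivAt_of_tendsto' (a := 0) (fun s _ => hd s)
      (((hdc.comp hline.continuous).integrable_of_hasCompactSupport hldc).integrableOn)
      (hlc.is_zero_at_infty.mono_left atTop_le_cocompact)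
    simpa using h3
  · have h4 : Integrable (fun p : ℝ × G => fderiv ℝ φ (p.1 • e + (p.2 : V)) e)
        (volume : Measure (ℝ × G)) :=
      (hdc.comp hjc).integrable_of_hasCompactSupport (hdsupp.comp_isClosedEmbedding hjemb)
    have h5 := h4.integrableOn (s := Set.Ici (0 : ℝ) ×ˢ (Set.univ : Set G))
    rwa [IntegrableOn, Measure.volume_eq_prod, ← Measure.prod_restrict,
      Measure.restrict_univ] at h5

end HausdorffOnSubspaces

/-! ### Approximate tangent planes of cones and of subsets of hyperplanes -/

/-- The approximate tangent planes of a cone contain the position vector. The mass of `M` in a ball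
`B(x, 2r)` is at most that of its dilate by `1 + rs`, which lies in `B(x + rs x, 3r)`; after
blowing up at `x`, the tangent plane must carry mass in `B(s x, 4)`, for every `s > 0`. If `x` were
not in the plane, this ball would be disjoint from it for large `s`. -/
theorem IsApproxTangentPlane.mem_of_cone {n k : ℕ} {M : Set (Space n)} {x : Space n}
    {P : Submodule ℝ (Space n)} (h : IsApproxTangentPlane k M x P)
    (hfin : IsLocallyFiniteMeasure (μHE[k].restrict M)) (hcone : ∀ t : ℝ, 0 < t → t • M = M) :
    x ∈ P := by
  by_contra hx
  -- `w` is normal to `P`, and `s` is chosen so that `s x` has distance 5 from `P`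
  set w : Space n := x - P.starProjection x with hw
  have hw0 : w ≠ 0 := fun h0 => hx (P.starProjection_eq_self_iff.1 (sub_eq_zero.1 h0).symm)
  have hwP : ∀ y ∈ P, ⟪y, w⟫ = 0 := fun y hy =>
    (P.mem_orthogonal w).1 (P.sub_starProjection_mem_orthogonal x) y hy
  have hxw : ⟪x, w⟫ = ‖w‖ ^ 2 := by
    have h1 : x = w + P.starProjection x := by simp [hw]
    rw [← real_inner_self_eq_norm_sq]
    conv_lhs => rw [h1]
    rw [inner_add_left, hwP _ (P.starProjection_apply_mem x), add_zero]
  have hwpos : 0 < ‖w‖ := norm_pos_iff.2 hw0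
  obtain ⟨s, hs⟩ : ∃ s : ℝ, s = 5 / ‖w‖ := ⟨_, rfl⟩
  have hspos : 0 < s := by rw [hs]; positivity
  let φ₁ : ContDiffBump (0 : Space n) := ⟨1, 2, by norm_num, by norm_num⟩
  let φ₂ : ContDiffBump (s • x) := ⟨3, 4, by norm_num, by norm_num⟩
  have hI₁ : 0 < ∫ y in (P : Set (Space n)), φ₁ y ∂μHE[k] :=
    setIntegral_submodule_pos P h.1 φ₁.continuous φ₁.hasCompactSupport (fun y => φ₁.nonneg)
      P.zero_mem (by
        rw [φ₁.one_of_mem_closedBall (Metric.mem_closedBall_self φ₁.rIn_pos.le)]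
        exact one_ne_zero)
  have hI₂ : ∫ y in (P : Set (Space n)), φ₂ y ∂μHE[k] = 0 := by
    refine setIntegral_eq_zero_of_forall_eq_zero fun y hy => φ₂.zero_of_le_dist ?_
    change (4 : ℝ) ≤ dist y (s • x)
    have h1 : ⟪s • x - y, w⟫ = 5 * ‖w‖ := by
      rw [inner_sub_left, real_inner_smul_left, hxw, hwP y hy, hs]
      field_simp
      ring
    have h2 : ⟪s • x - y, w⟫ ≤ ‖s • x - y‖ * ‖w‖ := real_inner_le_norm _ _
    rw [dist_comm, dist_eq_norm]
    have h3 : 5 ≤ ‖s • x - y‖ := le_of_mul_le_mul_right (h1 ▸ h2) hwpos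
    linarith
  refine absurd (hI₂ ▸ le_of_tendsto_of_tendsto (h.2 φ₁ φ₁.continuous φ₁.hasCompactSupport)
    (h.2 φ₂ φ₂.continuous φ₂.hasCompactSupport) ?_) (not_le.2 hI₁)
  have hsmall : ∀ᶠ r : ℝ in 𝓝[>] 0, r < 1 / (2 * s) :=
    (eventually_lt_nhds (by positivity : (0 : ℝ) < 1 / (2 * s))).filter_mono nhdsWithin_le_nhds
  filter_upwards [self_mem_nhdsWithin, hsmall] with r hr hrs
  have hr : 0 < r := hr
  have hrs' : r * s ≤ 1 / 2 := by
    rw [lt_div_iff₀ (by positivity)] at hrs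
    linarith
  have hrs0 : 0 < r * s := mul_pos hr hspos
  obtain ⟨t, ht⟩ : ∃ t : ℝ, t = 1 + r * s := ⟨_, rfl⟩
  have ht1 : 1 ≤ t := by linarith
  refine mul_le_mul_of_nonneg_left ?_ (by positivity)
  set B₁ := Metric.closedBall x (2 * r)
  set B₂ := Metric.closedBall (t • x) (3 * r)
  have hB₁ : MeasurableSet B₁ := Metric.isClosed_closedBall.measurableSet
  have hB₂ : MeasurableSet B₂ := Metric.isClosed_closedBall.measurableSet
  have hfinB : ∀ (c : Space n) (ρ : ℝ), μHE[k].restrict M (Metric.closedBall c ρ) ≠ ⊤ :=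
    fun c ρ => (isCompact_closedBall c ρ).measure_lt_top.ne
  have hle : μHE[k].restrict M B₁ ≤ μHE[k].restrict M B₂ := by
    rw [Measure.restrict_apply hB₁, Measure.restrict_apply hB₂]
    have hsub : t • (B₁ ∩ M) ⊆ B₂ ∩ M := by
      rintro _ ⟨y, ⟨hyB, hyM⟩, rfl⟩
      refine ⟨?_, ?_⟩
      · have h1 : dist y x ≤ 2 * r := hyB
        change dist (t • y) (t • x) ≤ 3 * r
        rw [dist_smul₀, Real.norm_of_nonneg (by linarith)]
        nlinarith
      · rw [← hcone t (by linarith)]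
        exact Set.smul_mem_smul_set hyM
    refine le_trans ?_ (measure_mono hsub)
    rw [Measure.euclideanHausdorffMeasure_smul₀ k (by linarith : t ≠ 0)]
    have h1 : (1 : NNReal) ≤ ‖t‖₊ ^ k := by
      refine one_le_pow₀ ?_
      rw [← NNReal.coe_le_coe]
      simpa [abs_of_pos (by linarith : 0 < t)] using ht1
    calc μHE[k] (B₁ ∩ M) = (1 : NNReal) • μHE[k] (B₁ ∩ M) := (one_smul _ _).symm
      _ ≤ ‖t‖₊ ^ k • μHE[k] (B₁ ∩ M) := by gcongr
  calc ∫ y in M, φ₁ (r⁻¹ • (y - x)) ∂μHE[k]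
      ≤ ∫ y in M, B₁.indicator (fun _ => (1 : ℝ)) y ∂μHE[k] := by
        refine integral_mono_of_nonneg (Eventually.of_forall fun y => φ₁.nonneg)
          ((integrable_indicator_iff hB₁).2 (integrableOn_const (hfinB _ _)))
          (Eventually.of_forall fun y => ?_)
        by_cases hy : y ∈ B₁
        · simpa [hy] using φ₁.le_one
        · have hy' : 2 * r < dist y x := not_le.1 hy
          simp only [hy, not_false_eq_true, Set.indicator_of_notMem]
          refine (φ₁.zero_of_le_dist ?_).le
          change (2 : ℝ) ≤ dist (r⁻¹ • (y - x)) 0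
          rw [dist_zero_right, norm_smul, Real.norm_of_nonneg (by positivity), ← dist_eq_norm,
            inv_mul_eq_div, le_div_iff₀ hr]
          exact hy'.le
    _ = (μHE[k].restrict M B₁).toReal := by
        rw [integral_indicator_const _ hB₁]
        simp [Measure.real]
    _ ≤ (μHE[k].restrict M B₂).toReal := ENNReal.toReal_mono (hfinB _ _) hle
    _ = ∫ y in M, B₂.indicator (fun _ => (1 : ℝ)) y ∂μHE[k] := by
        rw [integral_indicator_const _ hB₂]
        simp [Measure.real]
    _ ≤ ∫ y in M, φ₂ (r⁻¹ • (y - x)) ∂μHE[k] := by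
        refine integral_mono_of_nonneg
          (Eventually.of_forall fun y => Set.indicator_nonneg (fun _ _ => zero_le_one) y) ?_
          (Eventually.of_forall fun y => ?_)
        · have hemb : IsClosedEmbedding fun y : Space n => r⁻¹ • (y - x) :=
            ((Homeomorph.subRight x).trans
              (Homeomorph.smulOfNeZero r⁻¹ (inv_ne_zero hr.ne'))).isClosedEmbedding
          exact (φ₂.continuous.comp hemb.continuous).integrable_of_hasCompactSupport
            (φ₂.hasCompactSupport.comp_isClosedEmbedding hemb)
        · by_cases hy : y ∈ B₂
          · have hy' : dist y (t • x) ≤ 3 * r := hy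
            simp only [hy, Set.indicator_of_mem]
            refine (φ₂.one_of_mem_closedBall ?_).ge
            change dist (r⁻¹ • (y - x)) (s • x) ≤ 3
            have h1 : r⁻¹ • (y - x) - s • x = r⁻¹ • (y - t • x) := by
              rw [ht, smul_sub, smul_sub, smul_smul, mul_add, mul_one, ← mul_assoc,
                inv_mul_cancel₀ hr.ne', one_mul, add_smul, sub_sub]
            rw [dist_eq_norm, h1, norm_smul, Real.norm_of_nonneg (by positivity), ← dist_eq_norm,
              inv_mul_eq_div, div_le_iff₀ hr]
            exact hy'
          · simpa [hy] using φ₂.nonneg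

/-- A `k`-dimensional subspace containing `M` is the only possible approximate tangent plane of
`M` at points of the subspace. -/
theorem IsApproxTangentPlane.eq_of_subset {n k : ℕ} {M : Set (Space n)} {x : Space n}
    {P Q : Submodule ℝ (Space n)} (h : IsApproxTangentPlane k M x P)
    (hQ : Module.finrank ℝ Q = k) (hM : M ⊆ Q) (hx : x ∈ Q) : P = Q := by
  refine Submodule.eq_of_le_of_finrank_eq (fun z hz => ?_) (h.1.trans hQ.symm)
  by_contra hzQ
  obtain ⟨ρ, hρ, hball⟩ := Metric.isOpen_iff.1
    Q.closed_of_finiteDimensional.isOpen_compl z hzQ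
  let φ : ContDiffBump z := ⟨ρ / 2, ρ, by positivity, by linarith⟩
  have hI : 0 < ∫ y in (P : Set (Space n)), φ y ∂μHE[k] :=
    setIntegral_submodule_pos P h.1 φ.continuous φ.hasCompactSupport (fun y => φ.nonneg) hz (by
      rw [φ.one_of_mem_closedBall (Metric.mem_closedBall_self φ.rIn_pos.le)]
      exact one_ne_zero)
  have h0 : ∀ r : ℝ, (r ^ k)⁻¹ * ∫ y in M, φ (r⁻¹ • (y - x)) ∂μHE[k] = 0 := by
    intro r
    rw [setIntegral_eq_zero_of_forall_eq_zero fun y hy => φ.zero_of_le_dist ?_, mul_zero]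
    refine not_lt.1 fun hlt => hball hlt ?_
    exact Q.smul_mem _ (Q.sub_mem (hM hy) hx)
  have hlim := h.2 φ φ.continuous φ.hasCompactSupport
  simp only [h0] at hlim
  exact hI.ne (tendsto_nhds_unique tendsto_const_nhds hlim)

theorem mem_tangentPlane_of_cone {n k : ℕ} {M : Set (Space n)}
    (hfin : IsLocallyFiniteMeasure (μHE[k].restrict M)) (hcone : ∀ t : ℝ, 0 < t → t • M = M)
    (x : Space n) : x ∈ tangentPlane k M x := by
  unfold tangentPlane
  split_ifs with h
  · exact h.choose_spec.mem_of_cone hfin hcone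
  · trivial

theorem le_tangentPlane_of_subset {n k : ℕ} {M : Set (Space n)} {Q : Submodule ℝ (Space n)}
    (hQ : Module.finrank ℝ Q = k) (hM : M ⊆ Q) {x : Space n}
    (hx : x ∈ Q) : Q ≤ tangentPlane k M x := by
  unfold tangentPlane
  split_ifs with h
  · exact (h.choose_spec.eq_of_subset hQ hM hx).ge
  · exact le_top

/-! ### Half-spaces, the boundary hyperplane and the edge -/

theorem inner_lastVec {n : ℕ} (x : Space n) : ⟪x, lastVec n⟫ = x (Fin.last n) := by
  simp [lastVec, EuclideanSpace.inner_single_right]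

theorem norm_lastVec (n : ℕ) : ‖lastVec n‖ = 1 := by simp [lastVec]

theorem mem_wall_iff {n : ℕ} {x : Space n} : x ∈ wall n ↔ ⟪x, lastVec n⟫ = 0 := by
  rw [inner_lastVec]; rfl

/-- The subspace of the boundary hyperplane orthogonal to `e`. -/
noncomputable def edge {n : ℕ} (e : Space n) : Submodule ℝ (Space n) := (ℝ ∙ e)ᗮ ⊓ (ℝ ∙ lastVec n)ᗮ

theorem mem_edge_iff {n : ℕ} {e x : Space n} : x ∈ edge e ↔ ⟪x, e⟫ = 0 ∧ ⟪x, lastVec n⟫ = 0 := by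
  simp only [edge, Submodule.mem_inf, Submodule.mem_orthogonal_singleton_iff_inner_left]

theorem finrank_edge {m : ℕ} {e : Space (m + 1)} (he : ‖e‖ = 1) (heE : ⟪e, lastVec (m + 1)⟫ = 0) :
    Module.finrank ℝ (edge e) = m := by
  have ho : Orthonormal ℝ ![e, lastVec (m + 1)] := by
    simp [orthonormal_vecCons_iff, he, norm_lastVec, heE]
  have h2 : Module.finrank ℝ (Submodule.span ℝ (Set.range ![e, lastVec (m + 1)])) = 2 := by
    simpa using finrank_span_eq_card ho.linearIndependent
  have h3 : edge e = (Submodule.span ℝ (Set.range ![e, lastVec (m + 1)]))ᗮ := by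
    rw [edge, Submodule.inf_orthogonal, Matrix.range_cons, Matrix.range_cons, Matrix.range_empty,
      Set.union_empty, Submodule.span_union]
  have h4 := Submodule.finrank_add_finrank_orthogonal
    (Submodule.span ℝ (Set.range ![e, lastVec (m + 1)]))
  rw [← h3, h2, finrank_euclideanSpace_fin] at h4
  omega

theorem frontier_halfPlus {n : ℕ} {ν : Space n} (hν : ν ≠ 0) :
    frontier (halfPlus ν) = {x | ⟪x, ν⟫ = 0} := by
  have hsurj : Function.Surjective (innerSL ℝ ν) := fun c =>
    ⟨(c / ⟪ν, ν⟫) • ν, by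
      rw [innerSL_apply_apply, real_inner_smul_right, div_mul_cancel₀ _ (inner_self_ne_zero.2 hν)]⟩
  have h1 : halfPlus ν = innerSL ℝ ν ⁻¹' Set.Ici 0 := by
    ext x; simp [halfPlus, real_inner_comm]
  rw [h1, ← ((innerSL ℝ ν).isOpenMap hsurj).preimage_frontier_eq_frontier_preimage
    (innerSL ℝ ν).continuous, frontier_Ici]
  ext x
  simp [real_inner_comm]

theorem frontier_halfMinus {n : ℕ} {ν : Space n} (hν : ν ≠ 0) :
    frontier (halfMinus ν) = {x | ⟪x, ν⟫ = 0} := by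
  have h1 : halfMinus ν = halfPlus (-ν) := by
    ext x; simp [halfMinus, halfPlus]
  rw [h1, frontier_halfPlus (neg_ne_zero.2 hν)]
  ext x
  simp

/-! ### The first variation along fields of constant direction -/

theorem divAlong_smul_const {n : ℕ} (P : Submodule ℝ (Space n)) {φ : Space n → ℝ} {x : Space n}
    (hφ : DifferentiableAt ℝ φ x) (w : Space n) :
    divAlong P (fun y => φ y • w) x = fderiv ℝ φ x (P.starProjection w) := by
  have h1 : (P.starProjection ∘L fderiv ℝ (fun y => φ y • w) x).toLinearMap
      = LinearMap.smulRight (fderiv ℝ φ x).toLinearMap (P.starProjection w) := by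
    rw [(hφ.hasFDerivAt.smul_const w).fderiv]
    ext v
    simp
  rw [divAlong, h1, LinearMap.trace_smulRight]
  rfl

/-- The first variation of a stationary triple along `X = φ (a e + b E)`, where `E` is the last
coordinate vector and `e` the inner unit normal of `T` in the boundary hyperplane; the term on `T`
has been turned into an integral over the edge by the divergence theorem. -/
theorem IsStationaryTriple.firstVariation_smul {m : ℕ} {θ : ℝ} {M : Set (Space (m + 1))}
    {ψ : Space (m + 1) → ℝ} {ν e : Space (m + 1)} {s c : ℝ} (hs : 0 < s) (he : ‖e‖ = 1)
    (heE : ⟪e, lastVec (m + 1)⟫ = 0) (hν : ν = s • e + c • lastVec (m + 1))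
    (hstat : IsStationaryTriple θ M ψ (halfPlus ν ∩ wall (m + 1))
      (frontier (halfPlus ν) ∩ wall (m + 1)))
    {φ : Space (m + 1) → ℝ} (hφ : ContDiff ℝ 1 φ) (hc : HasCompactSupport φ) (h0 : ∀ x, 0 ≤ φ x)
    (a : ℝ) {b : ℝ} (hb : 0 ≤ b) :
    ∫ x in M, ψ x * fderiv ℝ φ x
        ((tangentPlane (m + 1) M x).starProjection (a • e + b • lastVec (m + 1))) ∂μHE[m + 1]
      = -(a * Real.cos θ + b * Real.sin θ) * ∫ x in (edge e : Set (Space (m + 1))), φ x ∂μHE[m] := by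
  obtain ⟨H, hH, hH0⟩ := hstat
  set E := lastVec (m + 1) with hE
  have hEE : ⟪E, E⟫ = 1 := by simp [hE, norm_lastVec]
  have hee : ⟪e, e⟫ = 1 := by simp [he]
  have hinner : ∀ x, ⟪x, ν⟫ = s * ⟪x, e⟫ + c * ⟪x, E⟫ := fun x => by
    rw [hν, inner_add_right, real_inner_smul_right, real_inner_smul_right]
  have hwE : ⟪a • e + b • E, E⟫ = b := by
    rw [inner_add_left, real_inner_smul_left, real_inner_smul_left, heE, hEE]; simp
  have hν0 : ν ≠ 0 := by
    intro h
    have := hinner e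
    rw [h, inner_zero_right, hee, heE] at this
    linarith
  have hX : IsAdmissible (fun x => φ x • (a • e + b • E)) :=
    ⟨hφ.smul contDiff_const, hc.smul_right, fun p _ => by
      rw [← hE, real_inner_smul_left, hwE]; exact mul_nonneg (h0 p) hb⟩
  have hT : halfPlus ν ∩ wall (m + 1) = {x | 0 ≤ ⟪x, e⟫ ∧ x - ⟪x, e⟫ • e ∈ edge e} := by
    ext x
    simp only [Set.mem_inter_iff, mem_wall_iff, Set.mem_ofPred_eq, mem_edge_iff, inner_sub_left,
      real_inner_smul_left, hee, halfPlus, hinner, heE, ← hE]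
    constructor
    · rintro ⟨h1, h2⟩
      rw [h2, mul_zero, add_zero] at h1
      exact ⟨nonneg_of_mul_nonneg_right h1 hs, by ring, by rw [h2]; ring⟩
    · rintro ⟨h1, -, h2⟩
      have h3 : ⟪x, E⟫ = 0 := by linarith
      rw [h3]
      exact ⟨by rw [mul_zero, add_zero]; exact mul_nonneg hs.le h1, rfl⟩
  have hΓ : frontier (halfPlus ν) ∩ wall (m + 1) = (edge e : Set (Space (m + 1))) := by
    ext x
    simp only [frontier_halfPlus hν0, Set.mem_inter_iff, mem_wall_iff, Set.mem_ofPred_eq, hinner,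
      SetLike.mem_coe, mem_edge_iff, ← hE]
    refine and_congr_left fun h2 => ?_
    simp [h2, hs.ne']
  have hproj : (ℝ ∙ E)ᗮ.starProjection (a • e + b • E) = a • e := by
    refine Submodule.eq_starProjection_of_mem_orthogonal ?_ ?_
    · rw [Submodule.mem_orthogonal_singleton_iff_inner_left, real_inner_smul_left, heE, mul_zero]
    · rw [add_sub_cancel_left, Submodule.orthogonal_orthogonal]
      exact Submodule.smul_mem _ _ (Submodule.mem_span_singleton_self E)
  have hdiff : ∀ x, DifferentiableAt ℝ φ x := fun x => hφ.differentiable one_ne_zero x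
  have hfv := hH.firstVariation _ hX
  have hHzero : ∫ x in M, ψ x * ⟪φ x • (a • e + b • E), H x⟫ ∂μHE[m + 1] = 0 := by
    rw [← integral_zero (Space (m + 1)) ℝ (μ := μHE[m + 1].restrict M)]
    refine integral_congr_ae ?_
    filter_upwards [hH0] with x hx
    simp [hx]
  have hTint : ∫ x in halfPlus ν ∩ wall (m + 1), divWall (fun x => φ x • (a • e + b • E)) x
      ∂μHE[m + 1] = -(a * ∫ x in (edge e : Set (Space (m + 1))), φ x ∂μHE[m]) := by
    have h1 : ∀ x, divWall (fun x => φ x • (a • e + b • E)) x = a * fderiv ℝ φ x e := fun x => by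
      rw [divWall, divAlong_smul_const _ (hdiff x), ← hE, hproj, map_smul, smul_eq_mul]
    simp only [h1]
    rw [integral_const_mul, hT, setIntegral_halfSpace_fderiv (edge e) (finrank_edge he heE) he
      (fun y hy => (mem_edge_iff.1 hy).1) hφ hc, mul_neg]
  have hΓint : ∫ x in frontier (halfPlus ν) ∩ wall (m + 1), ⟪φ x • (a • e + b • E), E⟫
      ∂μHE[m + 1 - 1] = b * ∫ x in (edge e : Set (Space (m + 1))), φ x ∂μHE[m] := by
    rw [hΓ, Nat.add_sub_cancel]
    simp only [real_inner_smul_left, hwE]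
    rw [integral_mul_const, mul_comm]
  rw [hHzero, hTint, hΓint, Real.cos_pi_sub] at hfv
  simp only [divOn, divAlong_smul_const _ (hdiff _)] at hfv
  linear_combination hfv

/-! ### Test functions -/

theorem hasDerivAt_sq_max_zero (u : ℝ) :
    HasDerivAt (fun u : ℝ => (max 0 u) ^ 2) (2 * max 0 u) u := by
  rcases lt_trichotomy u 0 with hu | rfl | hu
  · rw [max_eq_left hu.le, mul_zero]
    refine (hasDerivAt_const u (0 : ℝ)).congr_of_eventuallyEq ?_
    filter_upwards [eventually_lt_nhds hu] with v hv
    simp [max_eq_left hv.le]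
  · rw [max_self, mul_zero]
    -- at the origin the function is `O(u ^ 2)`
    refine HasDerivAt.of_isLittleO ?_
    have h1 : (fun u : ℝ => (max 0 u) ^ 2) =O[𝓝 0] fun u : ℝ => u ^ 2 := by
      refine Asymptotics.IsBigO.of_bound 1 (Eventually.of_forall fun v => ?_)
      rw [one_mul, Real.norm_of_nonneg (by positivity), Real.norm_of_nonneg (by positivity)]
      rcases le_total v 0 with h | h
      · rw [max_eq_left h]; simpa using sq_nonneg v
      · rw [max_eq_right h]
    have h2 : (fun u : ℝ => u ^ 2) =o[𝓝 0] fun u : ℝ => u := by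
      simpa using Asymptotics.isLittleO_pow_pow (𝕜 := ℝ) (m := 1) (n := 2) one_lt_two
    simpa using h1.trans_isLittleO h2
  · rw [max_eq_right hu.le]
    have h1 : HasDerivAt (fun u : ℝ => u ^ 2) (2 * u) u := by simpa using hasDerivAt_pow 2 u
    refine h1.congr_of_eventuallyEq ?_
    filter_upwards [eventually_gt_nhds hu] with v hv
    simp [max_eq_right hv.le]

theorem contDiff_sq_max_zero : ContDiff ℝ 1 fun u : ℝ => (max 0 u) ^ 2 := by
  rw [contDiff_one_iff_deriv]
  refine ⟨fun u => (hasDerivAt_sq_max_zero u).differentiableAt, ?_⟩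
  rw [show deriv (fun u : ℝ => (max 0 u) ^ 2) = fun u => 2 * max 0 u from
    funext fun u => (hasDerivAt_sq_max_zero u).deriv]
  fun_prop

section Radial

variable {V : Type*} [NormedAddCommGroup V]

/-- The positive part of `1 - |x|²`. Its square is a radial `C¹` function supported in the closed
unit ball, and strictly decreasing in `|x|` there. -/
def paraboloid (x : V) : ℝ := max 0 (1 - ‖x‖ ^ 2)

theorem paraboloid_nonneg (x : V) : 0 ≤ paraboloid x := le_max_left _ _

theorem paraboloid_pos {x : V} (hx : ‖x‖ < 1) : 0 < paraboloid x := by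
  refine lt_max_of_lt_right ?_
  nlinarith [norm_nonneg x]

theorem continuous_paraboloid : Continuous (paraboloid : V → ℝ) := by
  unfold paraboloid
  fun_prop

variable [InnerProductSpace ℝ V]

theorem hasCompactSupport_paraboloid [FiniteDimensional ℝ V] :
    HasCompactSupport (paraboloid : V → ℝ) := by
  have : ProperSpace V := FiniteDimensional.proper ℝ V
  refine HasCompactSupport.intro (isCompact_closedBall (0 : V) 1) fun x hx => ?_
  have hx' : 1 < ‖x‖ := by simpa using hx
  refine max_eq_left ?_
  nlinarith

theorem contDiff_paraboloid_sq : ContDiff ℝ 1 fun x : V => paraboloid x ^ 2 :=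
  contDiff_sq_max_zero.comp (contDiff_const.sub (contDiff_norm_sq ℝ))

theorem fderiv_paraboloid_sq (x v : V) :
    fderiv ℝ (fun x : V => paraboloid x ^ 2) x v = -4 * (paraboloid x * ⟪x, v⟫) := by
  have h1 : HasFDerivAt (fun x : V => 1 - ‖x‖ ^ 2) (-(2 • innerSL ℝ x)) x := by
    simpa using (hasStrictFDerivAt_norm_sq x).hasFDerivAt.const_sub 1
  have h2 := (hasDerivAt_sq_max_zero (1 - ‖x‖ ^ 2)).comp_hasFDerivAt x h1
  have h3 : fderiv ℝ (fun x : V => paraboloid x ^ 2) x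
      = (2 * max 0 (1 - ‖x‖ ^ 2)) • (-(2 • innerSL ℝ x)) := h2.fderiv
  rw [h3]
  simp [paraboloid]
  ring

/-- A cut-off function near the segment from `q + t v` down to the orthogonal complement of `v`,
extended by reflection: it is positive at the foot `q`, while its derivative along `v` vanishes at
all points `x` with `x · v ≥ 0` at distance at least `2 δ` from the end point `q + t v`. -/
theorem exists_segment_cutoff [FiniteDimensional ℝ V] {q v : V} (hv : ‖v‖ = 1)
    (hqv : ⟪q, v⟫ = 0) {t δ : ℝ} (ht : 0 ≤ t) (hδ : 0 < δ) :
    ∃ φ : V → ℝ, ContDiff ℝ 1 φ ∧ HasCompactSupport φ ∧ (∀ x, 0 ≤ φ x) ∧ φ q ≠ 0 ∧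
      ∀ x, 0 ≤ ⟪x, v⟫ → 2 * δ ≤ dist x (q + t • v) → fderiv ℝ φ x v = 0 := by
  have : ProperSpace V := FiniteDimensional.proper ℝ V
  let χ : ContDiffBump q := ⟨δ / 2, δ, by positivity, by linarith⟩
  let h : ContDiffBump (0 : ℝ) := ⟨t + δ / 2, t + δ, by positivity, by linarith⟩
  have hvv : ⟪v, v⟫ = 1 := by simp [hv]
  refine ⟨fun x => χ (x - ⟪x, v⟫ • v) * h ⟪x, v⟫, ?_, ?_, ?_, ?_, ?_⟩
  · have h1 : ContDiff ℝ 1 fun x : V => ⟪x, v⟫ := contDiff_id.inner ℝ contDiff_const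
    exact (χ.contDiff.comp (contDiff_id.sub (h1.smul contDiff_const))).mul (h.contDiff.comp h1)
  · refine HasCompactSupport.intro (isCompact_closedBall q (t + 2 * δ)) fun x hx => ?_
    rw [Metric.mem_closedBall, not_le] at hx
    by_cases h1 : t + δ ≤ |⟪x, v⟫|
    · have : h ⟪x, v⟫ = 0 := h.zero_of_le_dist (by simpa using h1)
      simp [this]
    · have : χ (x - ⟪x, v⟫ • v) = 0 := by
        refine χ.zero_of_le_dist ?_
        change δ ≤ _
        have h2 := dist_triangle x (x - ⟪x, v⟫ • v) q
        have h3 : dist x (x - ⟪x, v⟫ • v) = |⟪x, v⟫| := by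
          rw [dist_eq_norm, sub_sub_cancel, norm_smul, hv, mul_one, Real.norm_eq_abs]
        linarith
      simp [this]
  · exact fun x => mul_nonneg χ.nonneg h.nonneg
  · have h1 : χ q = 1 := χ.one_of_mem_closedBall (Metric.mem_closedBall_self χ.rIn_pos.le)
    have h2 : h 0 = 1 := h.one_of_mem_closedBall (Metric.mem_closedBall_self h.rIn_pos.le)
    simp [hqv, h1, h2]
  · intro x hxv hx
    have hdiff : DifferentiableAt ℝ (fun x => χ (x - ⟪x, v⟫ • v) * h ⟪x, v⟫) x := by
      have h1 : ContDiff ℝ 1 fun x : V => ⟪x, v⟫ := contDiff_id.inner ℝ contDiff_const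
      exact ((χ.contDiff.comp (contDiff_id.sub (h1.smul contDiff_const))).mul
        (h.contDiff.comp h1)).differentiable one_ne_zero x
    rw [← hdiff.lineDeriv_eq_fderiv, lineDeriv]
    have hline : (fun τ : ℝ => χ (x + τ • v - ⟪x + τ • v, v⟫ • v) * h ⟪x + τ • v, v⟫)
        = fun τ => χ (x - ⟪x, v⟫ • v) * h (⟪x, v⟫ + τ) := by
      ext τ
      have h1 : ⟪x + τ • v, v⟫ = ⟪x, v⟫ + τ := by
        rw [inner_add_left, real_inner_smul_left, hvv, mul_one]
      rw [h1, add_smul, add_sub_add_right_eq_sub]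
    rw [hline, deriv_const_mul_field, mul_eq_zero]
    by_cases hχ : δ ≤ dist (x - ⟪x, v⟫ • v) q
    · exact Or.inl (χ.zero_of_le_dist hχ)
    right
    have h3 : dist x (q + t • v) ≤ dist (x - ⟪x, v⟫ • v) q + |⟪x, v⟫ - t| := by
      have h4 : x - (q + t • v) = (x - ⟪x, v⟫ • v - q) + (⟪x, v⟫ - t) • v := by
        rw [sub_smul]; abel
      rw [dist_eq_norm, dist_eq_norm, h4]
      refine (norm_add_le _ _).trans_eq ?_
      rw [norm_smul, hv, mul_one, Real.norm_eq_abs]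
    have h5 : δ < |⟪x, v⟫ - t| := by linarith [not_le.1 hχ]
    have hcont : ContinuousAt (fun τ : ℝ => |⟪x, v⟫ + τ|) 0 := by fun_prop
    rcases lt_abs.1 h5 with h6 | h6
    · have h7 : (fun τ : ℝ => h (⟪x, v⟫ + τ)) =ᶠ[𝓝 0] fun _ => 0 := by
        have h8 : t + δ < |⟪x, v⟫ + 0| := by rw [add_zero, abs_of_nonneg hxv]; linarith
        filter_upwards [hcont.eventually_const_lt h8] with τ hτ
        exact h.zero_of_le_dist (by simpa using hτ.le)
      rw [h7.deriv_eq, deriv_const]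
    · have h7 : (fun τ : ℝ => h (⟪x, v⟫ + τ)) =ᶠ[𝓝 0] fun _ => 1 := by
        have h8 : |⟪x, v⟫ + 0| < t + δ / 2 := by rw [add_zero, abs_of_nonneg hxv]; linarith
        filter_upwards [hcont.eventually_lt_const h8] with τ hτ
        exact h.one_of_mem_closedBall (by simpa using hτ.le)
      rw [h7.deriv_eq, deriv_const]

end Radial

/-! ### Stationary cones in a half-space -/

theorem IsNormalized.isClosed {n k : ℕ} {M : Set (Space n)} (h : IsNormalized k M) :
    IsClosed M := by
  refine isClosed_of_closure_subset fun x hx => (h x).2 fun ρ hρ => ?_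
  obtain ⟨y, hyM, hy⟩ := Metric.mem_closure_iff.1 hx (ρ / 2) (by positivity)
  refine ((h y).1 hyM (ρ / 2) (by positivity)).trans_le (measure_mono ?_)
  refine Set.inter_subset_inter_right _ (Metric.ball_subset_ball' ?_)
  rw [dist_comm]
  linarith

theorem IsStationaryTriple.integrable_paraboloid {m : ℕ} {θ : ℝ} {M T Γ : Set (Space (m + 1))}
    {ψ : Space (m + 1) → ℝ} (hstat : IsStationaryTriple θ M ψ T Γ) (w : Space (m + 1)) :
    Integrable (fun x => ψ x * (paraboloid x * ⟪x, w⟫)) (μHE[m + 1].restrict M) := by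
  obtain ⟨H, hH, -⟩ := hstat
  exact hH.ψ_locallyIntegrable.integrable_smul_right_of_hasCompactSupport
    (g := fun x => paraboloid x * ⟪x, w⟫)
    (continuous_paraboloid.mul (continuous_id.inner continuous_const))
    hasCompactSupport_paraboloid.mul_right

/-- The first variation of a stationary cone along a radial multiple of `ν = s e + c E`. Fields
pointing out of the half-space are not admissible, so the identity is proved for `e` and `E` and
extended by linearity. -/
theorem IsStationaryTriple.integral_paraboloid_mul_inner {m : ℕ} {θ : ℝ}
    {M : Set (Space (m + 1))} {ψ : Space (m + 1) → ℝ} {ν e : Space (m + 1)} {s c : ℝ} (hs : 0 < s)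
    (he : ‖e‖ = 1) (heE : ⟪e, lastVec (m + 1)⟫ = 0) (hν : ν = s • e + c • lastVec (m + 1))
    (hcone : IsVarifoldCone M ψ)
    (hstat : IsStationaryTriple θ M ψ (halfPlus ν ∩ wall (m + 1))
      (frontier (halfPlus ν) ∩ wall (m + 1))) :
    4 * ∫ x in M, ψ x * (paraboloid x * ⟪x, ν⟫) ∂μHE[m + 1]
      = (s * Real.cos θ + c * Real.sin θ)
        * ∫ x in (edge e : Set (Space (m + 1))), paraboloid x ^ 2 ∂μHE[m] := by
  have hfin : IsLocallyFiniteMeasure (μHE[m + 1].restrict M) := by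
    obtain ⟨H, hH, -⟩ := hstat
    exact hH.M_rectifiable.locallyFinite
  have key : ∀ a b : ℝ, 0 ≤ b →
      4 * ∫ x in M, ψ x * (paraboloid x * ⟪x, a • e + b • lastVec (m + 1)⟫) ∂μHE[m + 1]
        = (a * Real.cos θ + b * Real.sin θ)
          * ∫ x in (edge e : Set (Space (m + 1))), paraboloid x ^ 2 ∂μHE[m] := by
    intro a b hb
    have hsupp : HasCompactSupport fun x : Space (m + 1) => paraboloid x ^ 2 := by
      simp only [sq]
      exact hasCompactSupport_paraboloid.mul_right
    have h1 := hstat.firstVariation_smul hs he heE hν contDiff_paraboloid_sq hsupp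
      (fun x => sq_nonneg _) a hb
    -- the gradient of a radial function is tangent to a cone, so the projection drops out
    have h2 : ∀ x w, fderiv ℝ (fun x : Space (m + 1) => paraboloid x ^ 2) x
        ((tangentPlane (m + 1) M x).starProjection w) = -4 * (paraboloid x * ⟪x, w⟫) := by
      intro x w
      rw [fderiv_paraboloid_sq, ← Submodule.inner_starProjection_left_eq_right,
        Submodule.starProjection_eq_self_iff.2
          (mem_tangentPlane_of_cone hfin (fun t ht => (hcone t ht).1) x)]
    simp only [h2] at h1
    simp only [mul_left_comm (ψ _) (-4 : ℝ)] at h1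
    rw [integral_const_mul] at h1
    linarith
  have he' := key 1 0 le_rfl
  have hE' := key 0 1 zero_le_one
  simp only [one_smul, zero_smul, add_zero, zero_add] at he' hE'
  have hsplit : ∀ x, ψ x * (paraboloid x * ⟪x, ν⟫) = s * (ψ x * (paraboloid x * ⟪x, e⟫))
      + c * (ψ x * (paraboloid x * ⟪x, lastVec (m + 1)⟫)) := fun x => by
    rw [hν, inner_add_right, real_inner_smul_right, real_inner_smul_right]
    ring
  simp only [hsplit]
  rw [integral_add ((hstat.integrable_paraboloid e).const_mul s)
    ((hstat.integrable_paraboloid _).const_mul c), integral_const_mul, integral_const_mul]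
  linear_combination s * he' + c * hE'

/-- If `∫_M ψ (1 - |x|²)₊ x · ν = 0` for a cone `M` in `{x · ν ≤ 0}`, then `M` lies in the
hyperplane `ν^⊥`. -/
theorem inner_eq_zero_of_integral_paraboloid_eq_zero {n k : ℕ} {M : Set (Space n)}
    {ψ : Space n → ℝ} {ν : Space n} (hMm : MeasurableSet M) (hnorm : IsNormalized k M)
    (hcone : IsVarifoldCone M ψ) (hψ : ∀ x ∈ M, 0 < ψ x) (hM : M ⊆ halfMinus ν)
    (hint : Integrable (fun x => ψ x * (paraboloid x * ⟪x, ν⟫)) (μHE[k].restrict M))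
    (h0 : ∫ x in M, ψ x * (paraboloid x * ⟪x, ν⟫) ∂μHE[k] = 0) {x : Space n} (hx : x ∈ M) :
    ⟪x, ν⟫ = 0 := by
  by_contra hne
  have hneg : ⟪x, ν⟫ < 0 := lt_of_le_of_ne (hM hx) hne
  have hae : ∀ᵐ y ∂(μHE[k].restrict M), ψ y * (paraboloid y * ⟪y, ν⟫) = 0 := by
    have h1 : (fun y => -(ψ y * (paraboloid y * ⟪y, ν⟫))) =ᵐ[μHE[k].restrict M] 0 := by
      refine (integral_eq_zero_iff_of_nonneg_ae ?_ hint.neg).1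
        ((integral_neg _).trans (by rw [h0, neg_zero]))
      filter_upwards [ae_restrict_mem hMm] with y hy
      have h2 : paraboloid y * ⟪y, ν⟫ ≤ 0 :=
        mul_nonpos_of_nonneg_of_nonpos (paraboloid_nonneg y) (hM hy)
      have h3 : ψ y * (paraboloid y * ⟪y, ν⟫) ≤ 0 :=
        mul_nonpos_of_nonneg_of_nonpos (hψ y hy).le h2
      simpa using h3
    filter_upwards [h1] with y hy
    simpa using hy
  obtain ⟨t, ht⟩ : ∃ t : ℝ, t = (‖x‖ + 1)⁻¹ := ⟨_, rfl⟩
  have htpos : 0 < t := by rw [ht]; positivity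
  have htM : t • x ∈ M := by
    rw [← (hcone t htpos).1]
    exact Set.smul_mem_smul_set hx
  have hopen : IsOpen {y : Space n | ‖y‖ < 1 ∧ ⟪y, ν⟫ < 0} :=
    (isOpen_lt continuous_norm continuous_const).inter
      (isOpen_lt (f := fun y : Space n => ⟪y, ν⟫) (by fun_prop) continuous_const)
  have hmem : t • x ∈ {y : Space n | ‖y‖ < 1 ∧ ⟪y, ν⟫ < 0} := by
    refine ⟨?_, ?_⟩
    · rw [norm_smul, Real.norm_of_nonneg htpos.le, ht, inv_mul_eq_div,
        div_lt_one (by positivity)]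
      exact lt_add_one _
    · rw [real_inner_smul_left]
      exact mul_neg_of_pos_of_neg htpos hneg
  obtain ⟨ρ, hρ, hball⟩ := Metric.isOpen_iff.1 hopen _ hmem
  refine ((hnorm _).1 htM ρ hρ).ne' ?_
  rw [Set.inter_comm, ← Measure.restrict_apply Metric.isOpen_ball.measurableSet]
  refine measure_mono_null (fun y hy => ?_)
    (ae_iff.1 (hae.and (ae_restrict_mem hMm)))
  rintro ⟨hy0, hyM⟩
  obtain ⟨hy1, hy2⟩ := hball hy
  exact (mul_neg_of_pos_of_neg (hψ y hyM) (mul_neg_of_pos_of_neg (paraboloid_pos hy1) hy2)).ne hy0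

/-- A stationary triple whose contact angle is the angle `θ` of the half-hyperplane, and whose first
member lies in that half-hyperplane, fills all of it. If a point `q + t v` with `q` in the edge is
missing, stationarity is contradicted by a field `φ v` with `∂_v φ = 0` on `M` and `φ(q) > 0`. -/
theorem IsStationaryTriple.mem_of_subset_hyperplane {m : ℕ} {θ : ℝ} {M : Set (Space (m + 1))}
    {ψ : Space (m + 1) → ℝ} {ν e : Space (m + 1)} (hsin : 0 < Real.sin θ)
    (he : ‖e‖ = 1) (heE : ⟪e, lastVec (m + 1)⟫ = 0)
    (hν : ν = Real.sin θ • e + (-Real.cos θ) • lastVec (m + 1))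
    (hstat : IsStationaryTriple θ M ψ (halfPlus ν ∩ wall (m + 1))
      (frontier (halfPlus ν) ∩ wall (m + 1)))
    (hM : ∀ x ∈ M, ⟪x, ν⟫ = 0) {p : Space (m + 1)} (hpν : ⟪p, ν⟫ = 0)
    (hp : 0 ≤ ⟪p, lastVec (m + 1)⟫) : p ∈ M := by
  set E := lastVec (m + 1) with hE
  have hEE : ⟪E, E⟫ = 1 := by simp [hE, norm_lastVec]
  have hee : ⟪e, e⟫ = 1 := by simp [he]
  have hEe : ⟪E, e⟫ = 0 := by rw [real_inner_comm]; exact heE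
  have htrig := Real.sin_sq_add_cos_sq θ
  obtain ⟨v, hvdef⟩ : ∃ v, v = Real.cos θ • e + Real.sin θ • E := ⟨_, rfl⟩
  have hinv : ∀ x, ⟪x, v⟫ = Real.cos θ * ⟪x, e⟫ + Real.sin θ * ⟪x, E⟫ := fun x => by
    rw [hvdef, inner_add_right, real_inner_smul_right, real_inner_smul_right]
  have hinν : ∀ x, ⟪x, ν⟫ = Real.sin θ * ⟪x, e⟫ - Real.cos θ * ⟪x, E⟫ := fun x => by
    rw [hν, inner_add_right, real_inner_smul_right, real_inner_smul_right]; ring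
  have hve : ⟪v, e⟫ = Real.cos θ := by
    rw [hvdef, inner_add_left, real_inner_smul_left, real_inner_smul_left, hee, hEe]; ring
  have hvE : ⟪v, E⟫ = Real.sin θ := by
    rw [hvdef, inner_add_left, real_inner_smul_left, real_inner_smul_left, heE, hEE]; ring
  have hvv : ⟪v, v⟫ = 1 := by rw [hinv, hve, hvE]; linarith
  have hvν : ⟪v, ν⟫ = 0 := by rw [hinν, hve, hvE]; ring
  have hv : ‖v‖ = 1 := by
    have h1 : ‖v‖ ^ 2 = 1 := by rw [← real_inner_self_eq_norm_sq, hvv]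
    nlinarith [norm_nonneg v]
  -- on the hyperplane `ν^⊥`, the height over the boundary of the half-space is `sin θ (x · v)`
  have hheight : ∀ x, ⟪x, ν⟫ = 0 → ⟪x, E⟫ = Real.sin θ * ⟪x, v⟫ := fun x hx => by
    rw [hinν] at hx
    rw [hinv]
    linear_combination -Real.cos θ * hx - ⟪x, E⟫ * htrig
  have hvnonneg : ∀ x, ⟪x, ν⟫ = 0 → 0 ≤ ⟪x, E⟫ → 0 ≤ ⟪x, v⟫ := fun x hx hxE => by
    rw [hheight x hx] at hxE
    exact nonneg_of_mul_nonneg_right hxE hsin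
  obtain ⟨q, hq⟩ : ∃ q, q = p - ⟪p, v⟫ • v := ⟨_, rfl⟩
  have hqv : ⟪q, v⟫ = 0 := by rw [hq, inner_sub_left, real_inner_smul_left, hvv]; ring
  have hqν : ⟪q, ν⟫ = 0 := by
    rw [hq, inner_sub_left, real_inner_smul_left, hvν, hpν]; ring
  have hqE : ⟪q, E⟫ = 0 := by rw [hheight q hqν, hqv, mul_zero]
  have hqe : ⟪q, e⟫ = 0 := by
    have h1 := hinν q
    rw [hqν, hqE, mul_zero, sub_zero] at h1
    exact (mul_eq_zero.1 h1.symm).resolve_left hsin.ne'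
  have hpq : q + ⟪p, v⟫ • v = p := by rw [hq, sub_add_cancel]
  have hfin : Module.finrank ℝ (ℝ ∙ ν)ᗮ = m + 1 := by
    have hν0 : ν ≠ 0 := by
      intro h0
      have h1 := hinν e
      rw [h0, inner_zero_right, hee, heE] at h1
      linarith
    have h1 := Submodule.finrank_add_finrank_orthogonal (ℝ ∙ ν)
    rw [finrank_span_singleton hν0, finrank_euclideanSpace_fin] at h1
    omega
  by_contra hpM
  obtain ⟨H, hH, hH0⟩ := hstat
  obtain ⟨ρ, hρ, hball⟩ := Metric.isOpen_iff.1 hH.M_normalized.isClosed.isOpen_compl p hpM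
  obtain ⟨φ, hφ, hφc, hφ0, hφq, hφv⟩ := exists_segment_cutoff hv hqv (hvnonneg p hpν hp)
    (half_pos hρ)
  have hK : 0 < ∫ x in (edge e : Set (Space (m + 1))), φ x ∂μHE[m] :=
    setIntegral_submodule_pos _ (finrank_edge he heE) hφ.continuous hφc hφ0
      (mem_edge_iff.2 ⟨hqe, hqE⟩) hφq
  have hfv := IsStationaryTriple.firstVariation_smul hsin he heE hν ⟨H, hH, hH0⟩ hφ hφc hφ0
    (Real.cos θ) hsin.le
  rw [← hE, ← hvdef, setIntegral_eq_zero_of_forall_eq_zero] at hfv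
  · nlinarith
  · intro x hx
    have hxν : x ∈ (ℝ ∙ ν)ᗮ :=
      Submodule.mem_orthogonal_singleton_iff_inner_left.2 (hM x hx)
    have hvT : v ∈ tangentPlane (m + 1) M x :=
      le_tangentPlane_of_subset hfin
        (fun y hy => Submodule.mem_orthogonal_singleton_iff_inner_left.2 (hM y hy)) hxν
        (Submodule.mem_orthogonal_singleton_iff_inner_left.2 hvν)
    have hxE : 0 ≤ ⟪x, E⟫ := by
      rw [hE, inner_lastVec]
      exact hH.M_subset hx
    rw [Submodule.starProjection_eq_self_iff.2 hvT, hφv x (hvnonneg x (hM x hx) hxE), mul_zero]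
    rw [hpq]
    have h1 : ρ ≤ dist x p := not_lt.1 fun h => hball h hx
    linarith

/-- The boundary hyperplane of the half-space is too large to be locally rectifiable in
codimension two. -/
theorem not_isLocRectifiable_wall (m : ℕ) : ¬ IsLocRectifiable m (wall (m + 1)) := by
  intro h
  have hloc := h.locallyFinite
  have hwall : wall (m + 1) = ((ℝ ∙ lastVec (m + 1))ᗮ : Submodule ℝ (Space (m + 1))) := by
    ext x
    rw [mem_wall_iff, SetLike.mem_coe, Submodule.mem_orthogonal_singleton_iff_inner_left]
  have hdim : Module.finrank ℝ (ℝ ∙ lastVec (m + 1))ᗮ = m + 1 := by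
    have h0 : lastVec (m + 1) ≠ 0 := norm_pos_iff.1 (by rw [norm_lastVec]; exact one_pos)
    have h1 := Submodule.finrank_add_finrank_orthogonal (ℝ ∙ lastVec (m + 1))
    rw [finrank_span_singleton h0, finrank_euclideanSpace_fin] at h1
    omega
  have hfin : μHE[m] (wall (m + 1) ∩ Metric.ball 0 1) < ⊤ := by
    rw [Set.inter_comm, ← Measure.restrict_apply Metric.isOpen_ball.measurableSet]
    exact (measure_mono Metric.ball_subset_closedBall).trans_lt
      (isCompact_closedBall (0 : Space (m + 1)) 1).measure_lt_top
  rcases Measure.euclideanHausdorffMeasure_zero_or_top (Nat.lt_succ_self m)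
    (wall (m + 1) ∩ Metric.ball 0 1) with h0 | h0
  · rw [hwall] at h0
    exact (measure_submodule_inter_ball_pos _ hdim).ne' h0
  · exact hfin.ne h0

end Capillary

theorem mainTheorem6 (n : ℕ) (hn : 1 ≤ n) (θ : ℝ) (hθ0 : 0 < θ) (hθπ : θ < Real.pi)
    (ν : Capillary.Space n) (hν : ‖ν‖ = 1)
    (M : Set (Capillary.Space n)) (ψ : Capillary.Space n → ℝ)
    (hcone : Capillary.IsVarifoldCone M ψ)
    (hstat : Capillary.IsStationaryTriple θ M ψ
      (Capillary.halfPlus ν ∩ Capillary.wall n)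
      (frontier (Capillary.halfPlus ν) ∩ Capillary.wall n))
    (hM : M ⊆ Capillary.halfMinus ν) :
    Real.arccos ⟪ν, -Capillary.lastVec n⟫ ≤ θ ∧
      (Real.arccos ⟪ν, -Capillary.lastVec n⟫ = θ →
        M = frontier (Capillary.halfMinus ν) ∩ Capillary.upperHalf n) := by
  open Capillary in
  obtain ⟨m, rfl⟩ : ∃ m, n = m + 1 := ⟨n - 1, by omega⟩
  have hν0 : ν ≠ 0 := norm_pos_iff.1 (by rw [hν]; exact one_pos)
  set E := lastVec (m + 1) with hE
  have hEE : ⟪E, E⟫ = 1 := by simp [hE, norm_lastVec]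
  have hνν : ⟪ν, ν⟫ = 1 := by simp [hν]
  obtain ⟨c, hc⟩ : ∃ c, c = ⟪ν, E⟫ := ⟨_, rfl⟩
  have hEν : ⟪E, ν⟫ = c := by rw [hc, real_inner_comm]
  have hnorm : ‖ν - c • E‖ ^ 2 = 1 - c ^ 2 := by
    rw [← real_inner_self_eq_norm_sq, inner_sub_left, inner_sub_right, inner_sub_right,
      real_inner_smul_left, real_inner_smul_left, real_inner_smul_right, real_inner_smul_right,
      hEE, hνν, hEν, ← hc]
    ring
  obtain ⟨s, hs⟩ : ∃ s, s = ‖ν - c • E‖ := ⟨_, rfl⟩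
  -- `ν` is not normal to the boundary hyperplane, since otherwise `Γ` would be all of it
  have hs0 : s ≠ 0 := by
    intro h0
    have hνE : ν = c • E := by rwa [hs, norm_eq_zero, sub_eq_zero] at h0
    obtain ⟨H, hH, -⟩ := hstat
    have hΓ : frontier (halfPlus ν) ∩ wall (m + 1) = wall (m + 1) := by
      refine Set.inter_eq_right.2 fun x hx => ?_
      rw [frontier_halfPlus hν0]
      change ⟪x, ν⟫ = 0
      rw [hνE, real_inner_smul_right, mem_wall_iff.1 hx, mul_zero]
    have h1 := hH.Γ_rectifiable
    rw [hΓ, Nat.add_sub_cancel] at h1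
    exact not_isLocRectifiable_wall m h1
  have hspos : 0 < s := lt_of_le_of_ne (hs ▸ norm_nonneg _) hs0.symm
  obtain ⟨e, he⟩ : ∃ e, e = s⁻¹ • (ν - c • E) := ⟨_, rfl⟩
  have hse : ν = s • e + c • E := by
    rw [he, smul_smul, mul_inv_cancel₀ hs0, one_smul, sub_add_cancel]
  have he1 : ‖e‖ = 1 := by
    rw [he, norm_smul, norm_inv, Real.norm_of_nonneg hspos.le, ← hs, inv_mul_cancel₀ hs0]
  have heE : ⟪e, E⟫ = 0 := by
    rw [he, real_inner_smul_left, inner_sub_left, real_inner_smul_left, hEE, ← hc]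
    ring
  obtain ⟨α, hα⟩ : ∃ α, α = Real.arccos ⟪ν, -E⟫ := ⟨_, rfl⟩
  have hinner : ⟪ν, -E⟫ = -c := by rw [inner_neg_right, hc]
  have hsc : s ^ 2 = 1 - c ^ 2 := by rw [hs, hnorm]
  have hcosα : Real.cos α = -c := by
    rw [hα, hinner, Real.cos_arccos] <;> nlinarith
  have hsinα : Real.sin α = s := by
    rw [hα, hinner, Real.sin_arccos, neg_sq, ← hsc, Real.sqrt_sq hspos.le]
  have hid := hstat.integral_paraboloid_mul_inner hspos he1 heE hse hcone
  have hsub : s * Real.cos θ + c * Real.sin θ = Real.sin (α - θ) := by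
    rw [Real.sin_sub, hsinα, hcosα]
    ring
  have hK : 0 < ∫ x in (edge e : Set (Space (m + 1))), paraboloid x ^ 2 ∂μHE[m] := by
    refine setIntegral_submodule_pos _ (finrank_edge he1 heE) (continuous_paraboloid.pow 2) ?_
      (fun x => sq_nonneg _) (edge e).zero_mem
      (pow_ne_zero 2 (paraboloid_pos (by simp)).ne')
    simp only [sq]
    exact hasCompactSupport_paraboloid.mul_right
  rw [hsub] at hid
  have hstat' := hstat
  obtain ⟨H, hH, -⟩ := hstat'
  have hMm := hH.M_rectifiable.measurableSet
  have hle : ∫ x in M, ψ x * (paraboloid x * ⟪x, ν⟫) ∂μHE[m + 1] ≤ 0 := by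
    refine setIntegral_nonpos hMm fun x hx => ?_
    exact mul_nonpos_of_nonneg_of_nonpos (hH.ψ_pos x hx).le
      (mul_nonpos_of_nonneg_of_nonpos (paraboloid_nonneg x) (hM hx))
  rw [← hα]
  refine ⟨?_, fun hαθ => ?_⟩
  · by_contra hlt
    have hαπ : α ≤ Real.pi := hα ▸ Real.arccos_le_pi _
    have hsinpos : 0 < Real.sin (α - θ) :=
      Real.sin_pos_of_pos_of_lt_pi (by linarith) (by linarith)
    linarith [mul_pos hsinpos hK]
  · rw [hαθ, sub_self, Real.sin_zero, zero_mul] at hid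
    have hflat : ∀ x ∈ M, ⟪x, ν⟫ = 0 := fun x hx =>
      inner_eq_zero_of_integral_paraboloid_eq_zero hMm hH.M_normalized hcone hH.ψ_pos hM
        (hstat.integrable_paraboloid ν) (by linarith) hx
    rw [frontier_halfMinus hν0]
    refine Set.Subset.antisymm (fun x hx => ⟨hflat x hx, hH.M_subset hx⟩) ?_
    rintro p ⟨hpν, hpE⟩
    rw [hαθ] at hcosα hsinα
    refine hstat.mem_of_subset_hyperplane (hsinα ▸ hspos) he1 heE ?_ hflat hpν ?_
    · rw [hsinα, hcosα, neg_neg]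
      exact hse
    · rw [inner_lastVec]
      exact hpE
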